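/- Conventions. All polyhedra are compact polyhedra in some $\mathbb R^n$, i.e. underlying spaces of finite geometric simplicial complexes; a map from a polyhedron is PL if it is affine on each simplex of some finite triangulation of it. A PL $k$-sphere is a polyhedron PL homeomorphic to the boundary of a $(k+1)$-simplex. A closed PL $k$-manifold is a polyhedron with a finite triangulation of dimension at most $k$ in which the link of every $h$-simplex, $0\le h<k$, is a PL $(k-h-1)$-sphere. For $d>1$, a singular $d$-manifold is a polyhedron $N$ that admits a finite, connected, $d$-dimensional simplicial triangulation $K$ in which the links of vertices are closed connected PL $(d-1)$-manifolds and the link of every $h$-simplex, $0<h<d$, is a PL $(d-h-1)$-sphere; call such a $K$ a singular triangulation of $N$. A $(d+1)$-colored graph is a finite loopless multigraph $\Gamma$ (multiple edges allowed), regular of valency $d+1$, with a map $\gamma$ from its edges to $\{0,\dots,d\}$ that is injective on adjacent edges. Let $|K(\Gamma)|$ be the space obtained from one standard $d$-simplex, with vertices labeled $0,\dots,d$, for each vertex of $\Gamma$, by gluing, for each edge of color $c$, the simplices of its two ends along the faces opposite to their $c$-labeled vertices, equally labeled vertices being identified. $(\Gamma,\gamma)$ represents a polyhedron $N$ if there is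 a homeomorphism $|K(\Gamma)|\to N$ that is PL on each of these simplices. **Theorem.** Let $d>1$. Every singular $d$-manifold $N$ admits a $(d+1)$-colored graph representing it. More precisely, let $K$ be any singular triangulation of $N$ and $K'$ its first barycentric subdivision, each vertex of $K'$ being labeled by the dimension of the simplex of $K$ of which it is the barycenter. Let $\Gamma(K')$ be the dual graph of $K'$: its vertices are the $d$-simplices of $K'$; its edges are the $(d-1)$-simplices of $K'$ that lie in exactly two $d$-simplices, each joining these two; and an edge has as its color the element of $\{0,\dots,d\}$ that is not the label of any vertex of the corresponding $(d-1)$-simplex. Then $\Gamma(K')$ is a $(d+1)$-colored graph and represents $N$. -/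

import Mathlib

open Geometry

/-! ### Simplicial complexes and piecewise linear maps -/

/-- The link of a face `s` in `K`: the faces `t` disjoint from `s` such that `t ∪ s` is a face. -/
def Geometry.SimplicialComplex.faceLink {E : Type*} [AddCommGroup E] [Module ℝ E]
    (K : SimplicialComplex ℝ E) (s : Finset E) : SimplicialComplex ℝ E where
  faces := {t | t ∈ K.faces ∧ Disjoint t s ∧ ∃ u ∈ K.faces, (u : Set E) = (t : Set E) ∪ s}
  isRelLowerSet_faces := by
    classical
    rintro t ⟨ht, hd, u, hu, hut⟩
    refine ⟨K.nonempty_of_mem_faces ht, fun t' ht' hne =>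
      ⟨K.down_closed ht ht' hne, Finset.disjoint_of_subset_left ht' hd, t' ∪ s, ?_, by simp⟩⟩
    refine K.down_closed hu ?_ (hne.mono Finset.subset_union_left)
    rw [← Finset.coe_subset, hut, Finset.coe_union]
    exact Set.union_subset_union_left _ (Finset.coe_subset.2 ht')
  indep hs := K.indep hs.1
  inter_subset_convexHull hs ht := K.inter_subset_convexHull hs.1 ht.1

/-- A map from the polyhedron `P` is piecewise linear if it is affine on each simplex of some
finite triangulation of `P`. -/
def IsPLMap {E F : Type*} [AddCommGroup E] [Module ℝ E] [AddCommGroup F] [Module ℝ F]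
    {P : Set E} (f : P → F) : Prop :=
  ∃ L : SimplicialComplex ℝ E, L.faces.Finite ∧ L.space = P ∧
    ∀ s ∈ L.faces, ∃ g : E →ᵃ[ℝ] F, ∀ x : P, (x : E) ∈ convexHull ℝ (s : Set E) → f x = g x

/-- Two polyhedra are PL homeomorphic if there is a homeomorphism between them that is piecewise
linear in both directions. -/
def PLHomeomorphic {E F : Type*} [AddCommGroup E] [Module ℝ E] [TopologicalSpace E]
    [AddCommGroup F] [Module ℝ F] [TopologicalSpace F] (P : Set E) (Q : Set F) : Prop :=
  ∃ f : P ≃ₜ Q, IsPLMap (fun x => (f x : F)) ∧ IsPLMap (fun y => (f.symm y : E))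

/-- A PL `k`-sphere: a polyhedron PL homeomorphic to the boundary of the standard
`(k+1)`-simplex. -/
def IsPLSphere {E : Type*} [AddCommGroup E] [Module ℝ E] [TopologicalSpace E]
    (k : ℕ) (P : Set E) : Prop :=
  PLHomeomorphic P {x : Fin (k + 2) → ℝ | x ∈ stdSimplex ℝ (Fin (k + 2)) ∧ ∃ i, x i = 0}

/-- A closed PL `k`-manifold (not necessarily connected): a compact polyhedron with a finite
triangulation of dimension at most `k` in which the link of every `h`-simplex, `0 ≤ h < k`, is a
PL `(k-h-1)`-sphere. A face `s` is a simplex of dimension `s.card - 1`. -/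
def IsClosedPLManifold {E : Type*} [AddCommGroup E] [Module ℝ E] [TopologicalSpace E]
    (k : ℕ) (P : Set E) : Prop :=
  ∃ L : SimplicialComplex ℝ E, L.faces.Finite ∧ L.space = P ∧
    (∀ s ∈ L.faces, s.card ≤ k + 1) ∧
    ∀ s ∈ L.faces, s.card ≤ k → IsPLSphere (k - s.card) (L.faceLink s).space

/-! ### Singular manifolds -/

/-- `K` is a finite, connected, `d`-dimensional simplicial complex in which the links of vertices
are closed connected PL `(d-1)`-manifolds, and the link of every `h`-simplex, `0 < h < d`, is a PL
`(d-h-1)`-sphere. (For `h = d` the link is empty.) -/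
structure IsSingularTriangulation {E : Type*} [AddCommGroup E] [Module ℝ E] [TopologicalSpace E]
    (d : ℕ) (K : SimplicialComplex ℝ E) : Prop where
  finite : K.faces.Finite
  connected : IsConnected K.space
  card_le : ∀ s ∈ K.faces, s.card ≤ d + 1
  exists_card_eq : ∃ s ∈ K.faces, s.card = d + 1
  vertexLink : ∀ s ∈ K.faces, s.card = 1 →
    IsClosedPLManifold (d - 1) (K.faceLink s).space ∧ IsConnected (K.faceLink s).space
  faceLink : ∀ s ∈ K.faces, 2 ≤ s.card → s.card ≤ d →
    IsPLSphere (d - s.card) (K.faceLink s).space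

/-- A singular (PL) `d`-manifold, as a polyhedron in `E`. -/
def IsSingularManifold {E : Type*} [AddCommGroup E] [Module ℝ E] [TopologicalSpace E]
    (d : ℕ) (N : Set E) : Prop :=
  ∃ K : SimplicialComplex ℝ E, IsSingularTriangulation d K ∧ K.space = N

/-! ### Colored graphs and the polyhedra they represent -/

/-- `(G, γ)` is a (finite) `(d+1)`-colored graph: `G` is a finite loopless multigraph, regular of
valency `d + 1`, and `γ` colors its edges by `{0, …, d}`, injectively on adjacent edges. -/
structure IsColoredGraph {V W : Type*} (d : ℕ) (G : Graph V W) (γ : W → Fin (d + 1)) : Prop where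
  finite : G.vertexSet.Finite
  loopless : G.Loopless
  regular : ∀ v ∈ G.vertexSet, {e | G.Inc e v}.ncard = d + 1
  color_injective : ∀ e e' v, G.Inc e v → G.Inc e' v → γ e = γ e' → e = e'

/-- The elementary gluings: if `e` is an edge of color `c` joining `v` and `w`, then the simplices
of `v` and `w` are identified along their faces opposite to the vertices labeled `c`, respecting
the labels of the vertices. -/
def ColoredGluing {V W : Type*} {d : ℕ} (G : Graph V W) (γ : W → Fin (d + 1))
    (p q : Σ _ : G.vertexSet, stdSimplex ℝ (Fin (d + 1))) : Prop :=
  ∃ e, G.IsLink e p.1 q.1 ∧ p.2 = q.2 ∧ (p.2 : Fin (d + 1) → ℝ) (γ e) = 0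

/-- The space `|K(G)|`: one standard `d`-simplex for each vertex of `G`, its vertices labeled by
`{0, …, d}`, modulo the equivalence relation generated by the elementary gluings, with the quotient
topology. -/
abbrev ColoredRealization {V W : Type*} {d : ℕ} (G : Graph V W) (γ : W → Fin (d + 1)) : Type _ :=
  Quot (ColoredGluing G γ)

/-- `(G, γ)` represents the polyhedron `N`: there is a PL homeomorphism from `|K(G)|` to `N`, i.e.
a homeomorphism which is piecewise linear on each of the simplices of `K(G)`. -/
def Represents {V W : Type*} {d : ℕ} {E : Type*} [AddCommGroup E] [Module ℝ E]
    [TopologicalSpace E] (G : Graph V W) (γ : W → Fin (d + 1)) (N : Set E) : Prop :=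
  ∃ f : ColoredRealization G γ ≃ₜ N, ∀ v : G.vertexSet,
    IsPLMap (fun x : stdSimplex ℝ (Fin (d + 1)) => (f (Quot.mk _ ⟨v, x⟩) : E))

/-! ### The barycentric subdivision and its colored dual graph -/

/-- The first barycentric subdivision of `K`. Its vertices are (the barycenters of) the faces of
`K`; its simplices are the nonempty finite chains of faces of `K`. -/
def barycentricSubdivision {E : Type*} [AddCommGroup E] [Module ℝ E]
    (K : SimplicialComplex ℝ E) : PreAbstractSimplicialComplex (Finset E) where
  faces := {A | A.Nonempty ∧ (A : Set (Finset E)) ⊆ K.faces ∧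
    IsChain (· ⊆ ·) (A : Set (Finset E))}
  isRelLowerSet_faces := by
    rintro A ⟨hA, hAK, hc⟩
    exact ⟨hA, fun B hB hne => ⟨hne, (Finset.coe_subset.2 hB).trans hAK,
      hc.mono (Finset.coe_subset.2 hB)⟩⟩

/-- The dual graph of a complex of dimension `d`: its vertices are the `d`-simplices, and each
`(d-1)`-simplex that is contained in exactly two `d`-simplices is an edge joining these two. -/
def dualGraph {ι : Type*} (d : ℕ) (L : PreAbstractSimplicialComplex ι) :
    Graph (Finset ι) (Finset ι) where
  vertexSet := {s | s ∈ L.faces ∧ s.card = d + 1}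
  IsLink t s s' := t ∈ L.faces ∧ t.card = d ∧ s ≠ s' ∧
    {u | u ∈ L.faces ∧ u.card = d + 1 ∧ t ⊆ u} = {s, s'}
  isLink_symm := by
    rintro t -
    exact ⟨fun s s' ⟨h1, h2, h3, h4⟩ => ⟨h1, h2, h3.symm, by rw [h4, Set.pair_comm]⟩⟩
  eq_or_eq_of_isLink_of_isLink := by
    rintro t x y v w ⟨-, -, -, h⟩ ⟨-, -, -, h'⟩
    have hx : x ∈ ({v, w} : Set (Finset ι)) := h' ▸ h ▸ Set.mem_insert x {y}
    simpa using hx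
  left_mem_of_isLink := by
    rintro t x y ⟨-, -, -, h⟩
    have hx : x ∈ {u | u ∈ L.faces ∧ u.card = d + 1 ∧ t ⊆ u} := h ▸ Set.mem_insert x {y}
    exact ⟨hx.1, hx.2.1⟩

/-- The color of the edge dual to the `(d-1)`-simplex `t` of a complex with vertex-labeling `l`:
the label in `{0, …, d}` that no vertex of `t` has (unique if `t` has `d` distinct labels in
`{0, …, d}`). -/
noncomputable def dualColor {ι : Type*} (d : ℕ) (l : ι → ℕ) (t : Finset ι) : Fin (d + 1) :=
  Classical.epsilon fun c : Fin (d + 1) => ∀ v ∈ t, l v ≠ (c : ℕ)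

/-- The dimension of a (nonempty) simplex, given by its set of vertices. -/
def simplexDim {E : Type*} (s : Finset E) : ℕ := s.card - 1

/-! The simplex of a flag of faces is mapped linearly so that its vertex labeled i goes to the
barycenter of the i-dimensional face of the flag (`flagMap`). The claim is that these maps induce a
homeomorphism from the realization of the dual graph onto the polyhedron.

For the graph: given a complete flag and a dimension i, exactly one other flag differs from it only
in dimension i. For i < d this is pure combinatorics: the face can be completed by either of two
vertices. For i = d it holds because the link of a (d-1)-face is a 0-sphere. This yields regularity
and the coloring (`isColoredGraph`). Flags that differ only in dimension i have maps that agree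
where the i-th coordinate vanishes, so the maps descend to the quotient.

Surjectivity: every face lies in a d-face, and sorting the barycentric coordinates of a point of a
d-face exhibits a flag whose simplex contains it. Injectivity is the real issue, since the quotient
only knows gluings along facets. By `IsOrderedFace.eq_of_flagMap_eq`, two preimages of a point have
the same coordinates x, and their flags share the faces in the dimensions I where x is nonzero. A
chain of flags joining them and changing only dimensions outside I is therefore needed
(`reflTransGen_flagStep`). It comes from strong connectivity of stars
(`reflTransGen_adjacentAround`), which follows from connectedness of links by induction on
codimension, combined with sorting by adjacent transpositions within one d-face.

Of the conditions on links, only nonemptiness, connectedness in codimension at least two, and having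
two points in codimension one are used. -/

section Complexes

open scoped Classical

variable {E : Type*} [AddCommGroup E] [Module ℝ E]

/-! ### Simplicial complexes -/

/-- A complex with finite underlying space is a set of points. -/
theorem Geometry.SimplicialComplex.vertices_eq_space_of_finite (L : SimplicialComplex ℝ E)
    (h : L.space.Finite) : L.vertices = L.space := by
  refine L.vertices_subset_space.antisymm fun p hp => ?_
  obtain ⟨s, hs, hps⟩ := SimplicialComplex.mem_space_iff.1 hp
  have hsub : (convexHull ℝ (s : Set E)).Subsingleton := by
    by_contra hnt
    rw [Set.not_subsingleton_iff] at hnt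
    obtain ⟨x, hx, y, hy, hxy⟩ := hnt
    refine (h.subset (L.convexHull_subset_space hs)).not_infinite ?_
    refine Set.Infinite.mono ((convex_convexHull ℝ _).segment_subset hx hy) ?_
    rw [segment_eq_image_lineMap]
    exact (Set.Icc_infinite zero_lt_one).image (AffineMap.lineMap_injective ℝ hxy).injOn
  obtain ⟨a, ha⟩ := L.nonempty_of_mem_faces hs
  have hpa := hsub hps (subset_convexHull ℝ _ ha)
  exact L.down_closed hs (by simpa [hpa] using ha) (by simp)

theorem Geometry.SimplicialComplex.mem_faceLink {K : SimplicialComplex ℝ E} {s t : Finset E} :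
    t ∈ (K.faceLink s).faces ↔ t ∈ K.faces ∧ Disjoint t s ∧ t ∪ s ∈ K.faces := by
  refine and_congr_right fun _ => and_congr_right fun _ => ⟨?_, fun h => ⟨_, h, by simp⟩⟩
  rintro ⟨u, hu, h⟩
  rw [← Finset.coe_union, Finset.coe_inj] at h
  exact h ▸ hu

theorem Geometry.SimplicialComplex.singleton_mem_faceLink {K : SimplicialComplex ℝ E}
    {s : Finset E} {v : E} :
    {v} ∈ (K.faceLink s).faces ↔ v ∉ s ∧ insert v s ∈ K.faces := by
  rw [SimplicialComplex.mem_faceLink, Finset.disjoint_singleton_left, Finset.singleton_union]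
  exact ⟨fun h => h.2, fun h => ⟨K.down_closed h.2 (by simp) (by simp), h⟩⟩

/-- Two `d`-faces around `s` are adjacent if they arise from a common `(d-1)`-face containing `s`
by adding a vertex. -/
def AdjacentAround (d : ℕ) (K : SimplicialComplex ℝ E) (s S T : Finset E) : Prop :=
  ∃ F a b, F.card = d ∧ s ⊆ F ∧ a ∉ F ∧ b ∉ F ∧ S = insert a F ∧ T = insert b F ∧
    S ∈ K.faces ∧ T ∈ K.faces

variable [TopologicalSpace E]

/-- The `1`-skeleton of a finite simplicial complex with preconnected underlying space is
connected. -/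
theorem Geometry.SimplicialComplex.reflTransGen_of_isPreconnected_space
    [IsTopologicalAddGroup E] [ContinuousSMul ℝ E] [T2Space E]
    (L : SimplicialComplex ℝ E) (hfin : L.faces.Finite) (hc : IsPreconnected L.space) {x y : E}
    (hx : {x} ∈ L.faces) (hy : {y} ∈ L.faces) :
    Relation.ReflTransGen (fun a b => ∃ s ∈ L.faces, a ∈ s ∧ b ∈ s) x y := by
  set R := Relation.ReflTransGen (fun a b => ∃ s ∈ L.faces, a ∈ s ∧ b ∈ s) with hR
  by_contra hxy
  have hclosed : ∀ p : Finset E → Prop,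
      IsClosed (⋃ s ∈ {s | s ∈ L.faces ∧ p s}, convexHull ℝ (s : Set E)) := fun p =>
    (hfin.subset fun s hs => hs.1).isClosed_biUnion fun s _ =>
      (s.finite_toSet.isCompact_convexHull (𝕜 := ℝ)).isClosed
  -- Simplices with a vertex reachable from `x` and simplices with an unreachable one form two
  -- closed sets covering the space. They meet, and two simplices with a common point share a
  -- vertex, which would join the two classes.
  obtain ⟨z, -, hz, hz'⟩ := isPreconnected_closed_iff.1 hc _ _ (hclosed fun s => ∃ a ∈ s, R x a)
    (hclosed fun s => ∃ a ∈ s, ¬ R x a)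
    (by
      intro z hz
      obtain ⟨s, hs, hzs⟩ := SimplicialComplex.mem_space_iff.1 hz
      obtain ⟨a, ha⟩ := L.nonempty_of_mem_faces hs
      by_cases h : R x a
      · exact Or.inl (Set.mem_biUnion (x := s) ⟨hs, a, ha, h⟩ hzs)
      · exact Or.inr (Set.mem_biUnion (x := s) ⟨hs, a, ha, h⟩ hzs))
    ⟨x, L.subset_space hx (by simp), Set.mem_biUnion (x := {x})
      ⟨hx, x, by simp, Relation.ReflTransGen.refl⟩ (subset_convexHull ℝ _ (by simp))⟩
    ⟨y, L.subset_space hy (by simp), Set.mem_biUnion (x := {y})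
      ⟨hy, y, by simp, hxy⟩ (subset_convexHull ℝ _ (by simp))⟩
  simp only [Set.mem_iUnion] at hz hz'
  obtain ⟨s, ⟨hs, a, has, ha⟩, hzs⟩ := hz
  obtain ⟨t, ⟨ht, b, hbt, hb⟩, hzt⟩ := hz'
  have hne := convexHull_nonempty_iff.1 ⟨z, L.inter_subset_convexHull hs ht ⟨hzs, hzt⟩⟩
  obtain ⟨c, hcs, hct⟩ := hne
  exact hb ((ha.tail ⟨s, hs, has, hcs⟩).tail ⟨t, ht, hct, hbt⟩)

/-! ### PL spheres -/

theorem IsPLSphere.nonempty {k : ℕ} {P : Set E} (h : IsPLSphere k P) : P.Nonempty := by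
  obtain ⟨f, -⟩ := h
  refine ⟨_, (f.symm ⟨Pi.single 0 1, single_mem_stdSimplex ℝ 0, Fin.last _, ?_⟩).2⟩
  simp [Fin.ext_iff]

/-- The facets are convex, and since there are at least three vertices, any two facets share one. -/
theorem isPreconnected_boundary_stdSimplex {k : ℕ} (hk : 1 ≤ k) :
    IsPreconnected {x : Fin (k + 2) → ℝ | x ∈ stdSimplex ℝ (Fin (k + 2)) ∧ ∃ i, x i = 0} := by
  have h : {x : Fin (k + 2) → ℝ | x ∈ stdSimplex ℝ (Fin (k + 2)) ∧ ∃ i, x i = 0} =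
      ⋃ i, {x | x ∈ stdSimplex ℝ (Fin (k + 2)) ∧ x i = 0} := by
    ext x; simp
  rw [h]
  refine IsPreconnected.iUnion_of_reflTransGen (fun i => ?_) fun i j => .single ?_
  · exact Convex.isPreconnected ((convex_stdSimplex ℝ (Fin (k + 2))).inter
      (LinearMap.ker (LinearMap.proj (R := ℝ) (φ := fun _ : Fin (k + 2) => ℝ) i)).convex)
  · obtain ⟨l, hl⟩ : ∃ l, l ∉ ({i, j} : Finset (Fin (k + 2))) := by
      by_contra! hall
      have h1 := Finset.card_le_card fun x (_ : x ∈ Finset.univ) => hall x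
      have h2 := Finset.card_le_two (a := i) (b := j)
      simp only [Finset.card_univ, Fintype.card_fin] at h1
      omega
    simp only [Finset.mem_insert, Finset.mem_singleton, not_or] at hl
    exact ⟨Pi.single l 1, ⟨single_mem_stdSimplex ℝ l, by simp [Ne.symm hl.1]⟩,
      single_mem_stdSimplex ℝ l, by simp [Ne.symm hl.2]⟩

theorem IsPLSphere.isPreconnected {k : ℕ} {P : Set E} (hk : 1 ≤ k) (h : IsPLSphere k P) :
    IsPreconnected P := by
  obtain ⟨f, -⟩ := h
  have := (isPreconnected_iff_preconnectedSpace.1 (isPreconnected_boundary_stdSimplex hk))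
  rw [← Subtype.range_coe (s := P), ← f.symm.surjective.range_comp]
  exact isPreconnected_range (continuous_subtype_val.comp f.symm.continuous)

theorem IsPLSphere.ncard_eq_two {P : Set E} (h : IsPLSphere 0 P) : P.ncard = 2 := by
  obtain ⟨f, -⟩ := h
  rw [← Nat.card_coe_set_eq, Nat.card_congr f.toEquiv, Nat.card_coe_set_eq, Set.ncard_eq_two]
  refine ⟨Pi.single 0 1, Pi.single 1 1, fun h => by simpa using congrFun h 0, ?_⟩
  ext x
  change ((∀ i, 0 ≤ x i) ∧ ∑ i, x i = 1) ∧ (∃ i, x i = 0) ↔ x = Pi.single 0 1 ∨ x = Pi.single 1 1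
  change Fin 2 → ℝ at x
  rw [Fin.exists_fin_two, Fin.sum_univ_two]
  constructor
  · rintro ⟨⟨-, h⟩, h' | h'⟩
    · right; ext i; fin_cases i <;> simp_all
    · left; ext i; fin_cases i <;> simp_all
  · rintro (rfl | rfl) <;> simp [Fin.forall_fin_two]

/-! ### Singular triangulations as strongly connected pseudomanifolds -/

namespace IsSingularTriangulation

variable {d : ℕ} {K : SimplicialComplex ℝ E}

theorem faceLink_nonempty (hK : IsSingularTriangulation d K) {s : Finset E} (hs : s ∈ K.faces)
    (hsd : s.card ≤ d) : (K.faceLink s).space.Nonempty := by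
  have := (K.nonempty_of_mem_faces hs).card_pos
  rcases (show s.card = 1 ∨ 2 ≤ s.card by omega) with h | h
  · exact (hK.vertexLink s hs h).2.1
  · exact (hK.faceLink s hs h hsd).nonempty

theorem exists_insert_mem (hK : IsSingularTriangulation d K) {s : Finset E} (hs : s ∈ K.faces)
    (hsd : s.card ≤ d) : ∃ v ∉ s, insert v s ∈ K.faces := by
  obtain ⟨x, hx⟩ := hK.faceLink_nonempty hs hsd
  obtain ⟨t, ht, -⟩ := SimplicialComplex.mem_space_iff.1 hx
  obtain ⟨v, hv⟩ := SimplicialComplex.nonempty_of_mem_faces ht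
  exact ⟨v, SimplicialComplex.singleton_mem_faceLink.1
    (SimplicialComplex.down_closed ht (by simpa using hv) (by simp))⟩

/-- Purity: a face with at most `d` vertices has a nonempty link, so it can be enlarged by a vertex.
-/
theorem exists_superset (hK : IsSingularTriangulation d K) {s : Finset E} (hs : s ∈ K.faces) :
    ∃ S ∈ K.faces, s ⊆ S ∧ S.card = d + 1 := by
  induction h : d + 1 - s.card generalizing s with
  | zero => exact ⟨s, hs, subset_rfl, by have := hK.card_le s hs; omega⟩
  | succ k ih =>
    obtain ⟨v, hv, hvs⟩ := hK.exists_insert_mem hs (by omega)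
    obtain ⟨S, hS, hsS, hc⟩ := ih hvs (by rw [Finset.card_insert_of_notMem hv]; omega)
    exact ⟨S, hS, (Finset.subset_insert _ _).trans hsS, hc⟩

theorem faceLink_isPreconnected (hK : IsSingularTriangulation d K) {s : Finset E}
    (hs : s ∈ K.faces) (hsd : s.card < d) : IsPreconnected (K.faceLink s).space := by
  have := (K.nonempty_of_mem_faces hs).card_pos
  rcases (show s.card = 1 ∨ 2 ≤ s.card by omega) with h | h
  · exact (hK.vertexLink s hs h).2.2
  · exact (hK.faceLink s hs h hsd.le).isPreconnected (by omega)

/-- Every `(d-1)`-face lies in exactly two `d`-faces. -/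
theorem exists_pair (hd : 1 < d) (hK : IsSingularTriangulation d K) {F : Finset E}
    (hF : F ∈ K.faces) (hFd : F.card = d) :
    ∃ a b, a ≠ b ∧ ∀ x, (x ∉ F ∧ insert x F ∈ K.faces) ↔ x = a ∨ x = b := by
  -- Since `1 < d`, the face `F` has at least two vertices and falls under the sphere condition,
  -- here for a 0-sphere. Its two points must be vertices of the link.
  have h := hK.faceLink F hF (by omega) hFd.le
  rw [hFd, Nat.sub_self] at h
  have h2 := h.ncard_eq_two
  have hv := SimplicialComplex.vertices_eq_space_of_finite _
    (Set.finite_of_ncard_ne_zero (h2 ▸ two_ne_zero))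
  obtain ⟨a, b, hab, h3⟩ := Set.ncard_eq_two.1 h2
  refine ⟨a, b, hab, fun x => ?_⟩
  rw [← SimplicialComplex.singleton_mem_faceLink, ← SimplicialComplex.mem_vertices, hv, h3]
  simp

/-- The star of every face is strongly connected. -/
theorem reflTransGen_adjacentAround [IsTopologicalAddGroup E] [ContinuousSMul ℝ E]
    [T2Space E] (hK : IsSingularTriangulation d K) {s S T : Finset E}
    (hs : s ∈ K.faces) (hS : S ∈ K.faces) (hT : T ∈ K.faces) (hsS : s ⊆ S) (hsT : s ⊆ T)
    (hSd : S.card = d + 1) (hTd : T.card = d + 1) :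
    Relation.ReflTransGen (AdjacentAround d K s) S T := by
  induction h : d + 1 - s.card generalizing s S T with
  | zero =>
    have := Finset.eq_of_subset_of_card_le hsS (by omega)
    have := Finset.eq_of_subset_of_card_le hsT (by omega)
    subst_vars
    exact .refl
  | succ k ih =>
    rcases (show s.card = d ∨ s.card < d by omega) with hsd | hsd
    · obtain ⟨a, ha, rfl⟩ := Finset.exists_eq_insert_iff.2 ⟨hsS, by omega⟩
      obtain ⟨b, hb, rfl⟩ := Finset.exists_eq_insert_iff.2 ⟨hsT, by omega⟩
      exact .single ⟨s, a, b, hsd, subset_rfl, ha, hb, rfl, rfl, hS, hT⟩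
    -- The induction hypothesis, applied to the larger face `insert x s`.
    have around : ∀ x ∉ s, ∀ U V, U ∈ K.faces → V ∈ K.faces → insert x s ⊆ U → insert x s ⊆ V →
        U.card = d + 1 → V.card = d + 1 → Relation.ReflTransGen (AdjacentAround d K s) U V := by
      intro x hx U V hU hV hxU hxV hUd hVd
      refine Relation.ReflTransGen.mono ?_ _ _
        (ih (K.down_closed hU hxU (by simp)) hU hV hxU hxV hUd hVd ?_)
      · rintro _ _ ⟨F, a, b, hF, hxF, h⟩
        exact ⟨F, a, b, hF, (Finset.subset_insert _ _).trans hxF, h⟩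
      · rw [Finset.card_insert_of_notMem hx]; omega
    have vertex : ∀ U ∈ K.faces, s ⊆ U → U.card = d + 1 →
        ∃ v, insert v s ⊆ U ∧ {v} ∈ (K.faceLink s).faces := by
      intro U hU hsU hUd
      obtain ⟨v, hvU, hvs⟩ := Finset.exists_mem_notMem_of_card_lt_card (s := s) (t := U) (by omega)
      have hvU' := Finset.insert_subset hvU hsU
      exact ⟨v, hvU', SimplicialComplex.singleton_mem_faceLink.2
        ⟨hvs, K.down_closed hU hvU' (by simp)⟩⟩
    obtain ⟨v, hvS, hv⟩ := vertex S hS hsS hSd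
    obtain ⟨w, hwT, hw⟩ := vertex T hT hsT hTd
    -- Follow an edge path in the link. For consecutive vertices `y`, `z`, some `d`-face contains
    -- both of them and `s`, so it lies in the stars of both `insert y s` and `insert z s`; moving
    -- inside these stars is covered by `around`.
    have path := (K.faceLink s).reflTransGen_of_isPreconnected_space
      (hK.finite.subset fun t ht => ht.1) (hK.faceLink_isPreconnected hs hsd) hv hw
    clear hw
    induction path generalizing T with
    | refl =>
      exact around v (SimplicialComplex.singleton_mem_faceLink.1 hv).1 S T hS hT hvS hwT hSd hTd
    | @tail y z _ hyz ihp =>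
      obtain ⟨t, ht, hyt, hzt⟩ := hyz
      obtain ⟨-, hts, htK⟩ := SimplicialComplex.mem_faceLink.1 ht
      obtain ⟨U, hU, htU, hUd⟩ := hK.exists_superset htK
      have hsU := Finset.subset_union_right.trans htU
      have htU := Finset.subset_union_left.trans htU
      exact (ihp hU hsU hUd (Finset.insert_subset (htU hyt) hsU)).trans
        (around z (Finset.disjoint_left.1 hts hzt) U T hU hT (Finset.insert_subset (htU hzt) hsU)
          hwT hUd hTd)

end IsSingularTriangulation

end Complexes

section Flags

open scoped Classical

/-! ### Ordered faces and their flags -/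

variable {E : Type*} {d : ℕ}

/-- The set of the first `k` entries of `v`. -/
noncomputable def initialSegment (v : Fin (d + 1) → E) (k : ℕ) : Finset E :=
  (Finset.univ.filter fun i : Fin (d + 1) => (i : ℕ) < k).image v

/-- The flag of the nonempty initial segments of `v`. -/
noncomputable def flagOf (v : Fin (d + 1) → E) : Finset (Finset E) :=
  Finset.univ.image fun i : Fin (d + 1) => initialSegment v (i + 1)

/-- The flags of `u` and `v` have the same faces in all dimensions except possibly `i`. -/
def AgreeOff (i : Fin (d + 1)) (u v : Fin (d + 1) → E) : Prop :=
  ∀ j, j ≠ i → initialSegment u (j + 1) = initialSegment v (j + 1)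

theorem mem_initialSegment {v : Fin (d + 1) → E} {k : ℕ} {x : E} :
    x ∈ initialSegment v k ↔ ∃ i : Fin (d + 1), (i : ℕ) < k ∧ v i = x := by
  simp [initialSegment]

theorem initialSegment_mono (v : Fin (d + 1) → E) {k l : ℕ} (h : k ≤ l) :
    initialSegment v k ⊆ initialSegment v l := by
  intro x
  simp only [mem_initialSegment]
  rintro ⟨i, hi, rfl⟩
  exact ⟨i, hi.trans_le h, rfl⟩

theorem initialSegment_succ (v : Fin (d + 1) → E) (i : Fin (d + 1)) :
    initialSegment v (i + 1) = insert (v i) (initialSegment v i) := by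
  ext x
  simp only [mem_initialSegment, Finset.mem_insert, Nat.lt_succ_iff_lt_or_eq, or_and_right,
    exists_or, Fin.val_inj, exists_eq_left]
  rw [or_comm, eq_comm (a := x)]

theorem initialSegment_eq_image (v : Fin (d + 1) → E) :
    initialSegment v (d + 1) = Finset.univ.image v := by
  ext x; simp [mem_initialSegment, Nat.lt_succ_of_le (Fin.is_le _)]

theorem initialSegment_comp (v : Fin (d + 1) → E) (σ : Equiv.Perm (Fin (d + 1))) {k : ℕ}
    (h : ∀ j, (σ j : ℕ) < k ↔ (j : ℕ) < k) : initialSegment (v ∘ σ) k = initialSegment v k := by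
  ext x
  simp only [mem_initialSegment, Function.comp]
  constructor
  · rintro ⟨i, hi, rfl⟩
    exact ⟨σ i, (h i).2 hi, rfl⟩
  · rintro ⟨i, hi, rfl⟩
    exact ⟨σ.symm i, (h _).1 (by simpa using hi), by simp⟩

theorem initialSegment_congr {u v : Fin (d + 1) → E} {k : ℕ}
    (h : ∀ j : Fin (d + 1), (j : ℕ) < k → u j = v j) :
    initialSegment u k = initialSegment v k :=
  Finset.image_congr fun j hj => h j (by simpa using hj)

theorem apply_mem_initialSegment {v : Fin (d + 1) → E} (hv : v.Injective) {i : Fin (d + 1)}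
    {k : ℕ} : v i ∈ initialSegment v k ↔ (i : ℕ) < k := by
  rw [mem_initialSegment]
  exact ⟨fun ⟨j, hj, h⟩ => hv h ▸ hj, fun h => ⟨i, h, rfl⟩⟩

theorem card_initialSegment {v : Fin (d + 1) → E} (hv : v.Injective) {k : ℕ} (hk : k ≤ d + 1) :
    (initialSegment v k).card = k := by
  rw [initialSegment, Finset.card_image_of_injective _ hv, Fin.card_filter_val_lt,
    min_eq_right hk]

theorem initialSegment_mem_flagOf (v : Fin (d + 1) → E) (i : Fin (d + 1)) :
    initialSegment v (i + 1) ∈ flagOf v := Finset.mem_image_of_mem _ (Finset.mem_univ i)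

theorem mem_flagOf {v : Fin (d + 1) → E} {s : Finset E} :
    s ∈ flagOf v ↔ ∃ i : Fin (d + 1), initialSegment v (i + 1) = s := by
  simp [flagOf]

theorem initialSegment_injective {v : Fin (d + 1) → E} (hv : v.Injective) :
    Function.Injective fun i : Fin (d + 1) => initialSegment v (i + 1) := by
  intro i j h
  have := congrArg Finset.card h
  simp only at this
  rw [card_initialSegment hv (by omega), card_initialSegment hv (by omega)] at this
  omega

theorem card_flagOf {v : Fin (d + 1) → E} (hv : v.Injective) : (flagOf v).card = d + 1 := by
  rw [flagOf, Finset.card_image_of_injective _ (initialSegment_injective hv), Finset.card_univ,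
    Fintype.card_fin]

theorem flagOf_congr {u v : Fin (d + 1) → E}
    (h : ∀ i : Fin (d + 1), initialSegment u (i + 1) = initialSegment v (i + 1)) :
    flagOf u = flagOf v := by
  simp [flagOf, h]

/-- The segment of length `i` is the face of dimension `i - 1`, one of those on which the flags
agree, or is empty if `i = 0`. -/
theorem AgreeOff.initialSegment_eq {i : Fin (d + 1)} {u v : Fin (d + 1) → E}
    (h : AgreeOff i u v) : initialSegment u i = initialSegment v i := by
  rcases Nat.eq_zero_or_pos (i : ℕ) with h0 | h0
  · simp [initialSegment, h0]
  · have := h ⟨i - 1, by omega⟩ (by simp [Fin.ext_iff]; omega)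
    simpa [Nat.sub_add_cancel h0] using this

theorem AgreeOff.initialSegment_succ_eq {i : Fin (d + 1)} {u v : Fin (d + 1) → E}
    (h : AgreeOff i u v) : initialSegment u (i + 1) = insert (u i) (initialSegment v i) := by
  rw [initialSegment_succ, h.initialSegment_eq]

/-- A flag has one face of each cardinality, so a common face occupies the same position in both
flags. -/
theorem erase_subset_flagOf_iff {i : Fin (d + 1)} {u v : Fin (d + 1) → E} (hu : u.Injective)
    (hv : v.Injective) :
    (flagOf v).erase (initialSegment v (i + 1)) ⊆ flagOf u ↔ AgreeOff i u v := by
  constructor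
  · intro h j hj
    obtain ⟨l, hl⟩ := mem_flagOf.1 (h (Finset.mem_erase.2
      ⟨fun h => hj (initialSegment_injective hv h), initialSegment_mem_flagOf v j⟩))
    have hc := congrArg Finset.card hl
    rw [card_initialSegment hu (by omega), card_initialSegment hv (by omega)] at hc
    rw [← show _ = initialSegment v (j + 1) from hl, hc]
  · intro h s hs
    obtain ⟨hs, hsv⟩ := Finset.mem_erase.1 hs
    obtain ⟨j, rfl⟩ := mem_flagOf.1 hsv
    rw [← h j (fun hj => hs (by rw [hj]))]
    exact initialSegment_mem_flagOf u j

/-- Only the segment of length `i + 1` separates the positions `i` and `i + 1`. -/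
theorem agreeOff_swap (v : Fin (d + 1) → E) {i j : Fin (d + 1)} (hij : (j : ℕ) = i + 1) :
    AgreeOff i (v ∘ Equiv.swap i j) v := by
  intro k hk
  refine initialSegment_comp v _ fun l => ?_
  have hk' : (k : ℕ) ≠ i := fun h => hk (Fin.ext h)
  rw [Equiv.swap_apply_def]
  split_ifs with h1 h2
  · subst h1; omega
  · subst h2; omega
  · rfl

variable [AddCommGroup E] [Module ℝ E] {K : SimplicialComplex ℝ E}

/-- `v` enumerates the vertices of a `d`-face of `K`. -/
structure IsOrderedFace (K : SimplicialComplex ℝ E) (v : Fin (d + 1) → E) : Prop where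
  injective : v.Injective
  mem_faces : Finset.univ.image v ∈ K.faces

theorem IsOrderedFace.initialSegment_mem {v : Fin (d + 1) → E} (hv : IsOrderedFace K v) {k : ℕ}
    (hk : 0 < k) : initialSegment v k ∈ K.faces :=
  K.down_closed hv.mem_faces (Finset.image_subset_image (Finset.subset_univ _))
    ⟨v 0, (apply_mem_initialSegment hv.injective).2 (by simpa using hk)⟩

theorem IsOrderedFace.comp {v : Fin (d + 1) → E} (hv : IsOrderedFace K v)
    (σ : Equiv.Perm (Fin (d + 1))) : IsOrderedFace K (v ∘ σ) := by
  refine ⟨hv.injective.comp σ.injective, ?_⟩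
  rw [← Finset.image_image, Finset.image_univ_equiv]
  exact hv.mem_faces

theorem exists_isOrderedFace {S : Finset E} (hS : S ∈ K.faces) (hSd : S.card = d + 1) :
    ∃ v : Fin (d + 1) → E, IsOrderedFace K v ∧ Finset.univ.image v = S := by
  let e := S.equivFinOfCardEq hSd
  have h : Finset.univ.image (fun i => (e.symm i : E)) = S := by
    ext x
    simp only [Finset.mem_image, Finset.mem_univ, true_and]
    exact ⟨fun ⟨i, hi⟩ => hi ▸ (e.symm i).2, fun hx => ⟨e ⟨x, hx⟩, by simp⟩⟩
  exact ⟨fun i => e.symm i, ⟨Subtype.val_injective.comp e.symm.injective, by rwa [h]⟩, h⟩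

theorem IsOrderedFace.flagOf_mem {v : Fin (d + 1) → E} (hv : IsOrderedFace K v) :
    flagOf v ∈ (dualGraph d (barycentricSubdivision K)).vertexSet := by
  refine ⟨⟨⟨_, initialSegment_mem_flagOf v 0⟩, ?_, ?_⟩, card_flagOf hv.injective⟩
  · intro s hs
    obtain ⟨i, rfl⟩ := mem_flagOf.1 hs
    exact hv.initialSegment_mem (Nat.succ_pos _)
  · intro s hs t ht _
    obtain ⟨i, rfl⟩ := mem_flagOf.1 hs
    obtain ⟨j, rfl⟩ := mem_flagOf.1 ht
    exact (le_total i j).imp (fun h => initialSegment_mono v (by simpa using h))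
      fun h => initialSegment_mono v (by simpa using h)

/-- A chain of `d + 1` faces with cardinalities between 1 and `d + 1` attains each cardinality once.
Listing the vertex that each face adds to the previous one gives the enumeration. All later work
with flags goes through such enumerations. -/
theorem exists_flagOf_eq (hK : ∀ s ∈ K.faces, s.card ≤ d + 1) {A : Finset (Finset E)}
    (hA : A ∈ (dualGraph d (barycentricSubdivision K)).vertexSet) :
    ∃ v : Fin (d + 1) → E, IsOrderedFace K v ∧ flagOf v = A := by
  obtain ⟨⟨-, hAK, hchain⟩, hAd⟩ := hA
  have hsub : ∀ {s t}, s ∈ A → t ∈ A → s.card ≤ t.card → s ⊆ t := by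
    intro s t hs ht hst
    rcases hchain.total hs ht with h | h
    · exact h
    · exact (Finset.eq_of_subset_of_card_le h hst).symm.subset
  have hinj : Set.InjOn Finset.card (A : Set (Finset E)) := fun s hs t ht h =>
    (hsub hs ht h.le).antisymm (hsub ht hs h.ge)
  have himg : A.image Finset.card = Finset.Icc 1 (d + 1) := by
    refine Finset.eq_of_subset_of_card_le (fun k hk => ?_) ?_
    · obtain ⟨s, hs, rfl⟩ := Finset.mem_image.1 hk
      exact Finset.mem_Icc.2 ⟨(K.nonempty_of_mem_faces (hAK hs)).card_pos, hK s (hAK hs)⟩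
    · rw [Finset.card_image_of_injOn hinj, hAd]; simp
  have hex : ∀ i : Fin (d + 1), ∃ s ∈ A, s.card = i + 1 := fun i =>
    Finset.mem_image.1 (himg ▸ Finset.mem_Icc.2 (by omega))
  choose s hsA hsc using hex
  have hmono : ∀ {i j}, i ≤ j → s i ⊆ s j := fun {i j} hij =>
    hsub (hsA i) (hsA j) (by rw [hsc, hsc]; simpa using hij)
  have hnew : ∀ i, ∃ x ∈ s i, ∀ j < i, x ∉ s j := by
    intro i
    rcases Nat.eq_zero_or_pos (i : ℕ) with h0 | h0
    · obtain ⟨x, hx⟩ := K.nonempty_of_mem_faces (hAK (hsA i))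
      exact ⟨x, hx, fun j hj => by have := Fin.lt_def.1 hj; omega⟩
    · obtain ⟨x, hx, hx'⟩ := Finset.exists_mem_notMem_of_card_lt_card
        (s := s ⟨i - 1, by omega⟩) (t := s i) (by rw [hsc, hsc]; simp only; omega)
      refine ⟨x, hx, fun j hj hxj => hx' (hmono ?_ hxj)⟩
      rw [Fin.le_def]; have := Fin.lt_def.1 hj; simp only; omega
  choose v hvs hvn using hnew
  have hv : v.Injective := by
    intro i j hij
    by_contra hne
    rcases lt_or_gt_of_ne hne with h | h
    · exact hvn j i h (hij ▸ hvs i)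
    · exact hvn i j h (hij ▸ hvs j)
  have hseg : ∀ i : Fin (d + 1), initialSegment v (i + 1) = s i := by
    intro i
    refine Finset.eq_of_subset_of_card_le (fun x hx => ?_) ?_
    · obtain ⟨j, hj, rfl⟩ := mem_initialSegment.1 hx
      exact hmono (Fin.le_def.2 (Nat.lt_succ_iff.1 hj)) (hvs j)
    · rw [hsc, card_initialSegment hv (by omega)]
  refine ⟨v, ⟨hv, ?_⟩, ?_⟩
  · rw [← initialSegment_eq_image]
    exact hseg (Fin.last d) ▸ hAK (hsA _)
  · refine Finset.eq_of_subset_of_card_le (fun t ht => ?_) (by rw [hAd, card_flagOf hv])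
    obtain ⟨i, rfl⟩ := mem_flagOf.1 ht
    exact hseg i ▸ hsA i

/-! ### Adjacent flags -/

theorem IsOrderedFace.update_last {v : Fin (d + 1) → E} (hv : IsOrderedFace K v) {c : E}
    (hc : c ∉ initialSegment v (Fin.last d))
    (hcK : insert c (initialSegment v (Fin.last d)) ∈ K.faces) :
    IsOrderedFace K (Function.update v (Fin.last d) c) ∧
      AgreeOff (Fin.last d) (Function.update v (Fin.last d) c) v ∧
      Finset.univ.image (Function.update v (Fin.last d) c) =
        insert c (initialSegment v (Fin.last d)) := by
  have hu : AgreeOff (Fin.last d) (Function.update v (Fin.last d) c) v := by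
    intro j hj
    refine initialSegment_congr fun l hl => Function.update_of_ne ?_ _ _
    rintro rfl
    exact hj (Fin.last_le_iff.1 (Fin.le_def.2 (Nat.lt_succ_iff.1 hl)))
  have himg : Finset.univ.image (Function.update v (Fin.last d) c) =
      insert c (initialSegment v (Fin.last d)) := by
    have h := hu.initialSegment_succ_eq
    rwa [Function.update_self, Fin.val_last, initialSegment_eq_image] at h
  refine ⟨⟨?_, himg ▸ hcK⟩, hu, himg⟩
  rw [← Set.injOn_univ, ← Finset.coe_univ, ← Finset.card_image_iff, himg,
    Finset.card_insert_of_notMem hc, card_initialSegment hv.injective (by simp), Fin.val_last,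
    Finset.card_univ, Fintype.card_fin]

variable [TopologicalSpace E]

namespace IsSingularTriangulation

/-- Below the top dimension, exchange the vertices in positions `i` and `i + 1`; in the top
dimension, cross the `(d-1)`-face to the other `d`-face containing it. -/
theorem exists_agreeOff (hd : 1 < d) (hK : IsSingularTriangulation d K) {v : Fin (d + 1) → E}
    (hv : IsOrderedFace K v) (i : Fin (d + 1)) :
    ∃ u : Fin (d + 1) → E, IsOrderedFace K u ∧ AgreeOff i u v ∧
      initialSegment u (i + 1) ≠ initialSegment v (i + 1) := by
  rcases (show (i : ℕ) < d ∨ (i : ℕ) = d by omega) with hi | hi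
  · have hu := agreeOff_swap v (i := i) (j := ⟨i + 1, by omega⟩) rfl
    refine ⟨_, hv.comp _, hu, fun h => ?_⟩
    have h2 := hu.initialSegment_succ_eq ▸ Finset.mem_insert_self _ _
    rw [h, Function.comp, Equiv.swap_apply_left, apply_mem_initialSegment hv.injective] at h2
    simp at h2
  · have hF := hv.initialSegment_mem (k := i) (by omega)
    have hFd := card_initialSegment hv.injective (k := i) (by omega)
    obtain ⟨a, b, hab, h⟩ := hK.exists_pair hd hF (by omega)
    have hvF : v i ∉ initialSegment v i := by simp [apply_mem_initialSegment hv.injective]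
    obtain ⟨c, hcv, hcF, hcK⟩ : ∃ c, c ≠ v i ∧ c ∉ initialSegment v i ∧
        insert c (initialSegment v i) ∈ K.faces := by
      by_cases hva : a = v i
      · exact ⟨b, fun hb => hab (hva.trans hb.symm), (h b).2 (Or.inr rfl)⟩
      · exact ⟨a, hva, (h a).2 (Or.inl rfl)⟩
    obtain rfl : i = Fin.last d := Fin.ext hi
    obtain ⟨hu, huv, -⟩ := hv.update_last hcF hcK
    refine ⟨_, hu, huv, fun h2 => ?_⟩
    rw [huv.initialSegment_succ_eq, Function.update_self] at h2
    have h3 := h2 ▸ Finset.mem_insert_self c _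
    rw [initialSegment_succ, Finset.mem_insert] at h3
    exact h3.elim hcv hcF

/-- The new vertex at position `i` has only two candidates: the two vertices by which the face of
dimension `i + 1` exceeds the segment of length `i`, or, for `i = d`, those given by `exists_pair`.
The enumeration `v` takes one, which leaves the other for both `u` and `w`. -/
theorem initialSegment_eq_of_agreeOff (hd : 1 < d) (hK : IsSingularTriangulation d K)
    {u v w : Fin (d + 1) → E} (hu : IsOrderedFace K u) (hv : IsOrderedFace K v)
    (hw : IsOrderedFace K w) {i : Fin (d + 1)} (huv : AgreeOff i u v) (hwv : AgreeOff i w v)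
    (huv' : initialSegment u (i + 1) ≠ initialSegment v (i + 1))
    (hwv' : initialSegment w (i + 1) ≠ initialSegment v (i + 1)) :
    initialSegment w (i + 1) = initialSegment u (i + 1) := by
  obtain ⟨a, b, hab⟩ : ∃ a b, ∀ u' : Fin (d + 1) → E, IsOrderedFace K u' → AgreeOff i u' v →
      u' i = a ∨ u' i = b := by
    rcases (show (i : ℕ) < d ∨ (i : ℕ) = d by omega) with hi | hi
    · refine ⟨v i, v ⟨i + 1, by omega⟩, fun u' hu' h => ?_⟩
      have h1 := h ⟨i + 1, by omega⟩ (by simp [Fin.ext_iff])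
      have h2 : u' i ∈ initialSegment v (i + 1 + 1) := by
        rw [← h1, apply_mem_initialSegment hu'.injective]; simp only; omega
      obtain ⟨j, hj, hju⟩ := mem_initialSegment.1 h2
      have h3 : ¬ (j : ℕ) < i := by
        rw [← apply_mem_initialSegment hv.injective, hju, ← h.initialSegment_eq,
          apply_mem_initialSegment hu'.injective]
        exact lt_irrefl _
      rcases (show (j : ℕ) = i ∨ (j : ℕ) = i + 1 by omega) with h4 | h4
      · left; rw [← hju, Fin.ext h4]
      · right; rw [← hju]; congr 1; exact Fin.ext h4
    · obtain ⟨a, b, -, h⟩ := hK.exists_pair hd (hv.initialSegment_mem (k := i) (by omega))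
        ((card_initialSegment hv.injective (by omega)).trans hi)
      refine ⟨a, b, fun u' hu' hu'v => (h _).1 ⟨?_, ?_⟩⟩
      · rw [← hu'v.initialSegment_eq, apply_mem_initialSegment hu'.injective]
        exact lt_irrefl _
      · rw [← hu'v.initialSegment_succ_eq]
        exact hu'.initialSegment_mem (Nat.succ_pos _)
  rw [huv.initialSegment_succ_eq] at huv' ⊢
  rw [hwv.initialSegment_succ_eq] at hwv' ⊢
  rw [initialSegment_succ] at huv' hwv'
  rcases hab u hu huv with h1 | h1 <;> rcases hab w hw hwv with h2 | h2 <;>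
    rcases hab v hv (fun _ _ => rfl) with h3 | h3 <;> simp_all

theorem isLink_flagOf (hd : 1 < d) (hK : IsSingularTriangulation d K)
    {u v : Fin (d + 1) → E} (hu : IsOrderedFace K u) (hv : IsOrderedFace K v)
    {i : Fin (d + 1)} (huv : AgreeOff i u v)
    (huv' : initialSegment u (i + 1) ≠ initialSegment v (i + 1)) :
    (dualGraph d (barycentricSubdivision K)).IsLink
      ((flagOf v).erase (initialSegment v (i + 1))) (flagOf v) (flagOf u) := by
  have hc : ((flagOf v).erase (initialSegment v (i + 1))).card = d := by
    rw [Finset.card_erase_of_mem (initialSegment_mem_flagOf v i), card_flagOf hv.injective,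
      Nat.add_sub_cancel]
  refine ⟨?_, hc, ?_, ?_⟩
  · exact ((barycentricSubdivision K).isRelLowerSet_faces hv.flagOf_mem.1).2
      (Finset.erase_subset _ _) (Finset.card_pos.1 (by omega))
  · intro h
    obtain ⟨j, hj⟩ := mem_flagOf.1 (h ▸ initialSegment_mem_flagOf u i)
    have hc := congrArg Finset.card hj
    rw [card_initialSegment hu.injective (by omega), card_initialSegment hv.injective (by omega)]
      at hc
    exact huv' (by rw [← hj, hc])
  · ext U
    constructor
    · rintro ⟨hU, hUd, hsub⟩
      obtain ⟨w, hw, rfl⟩ := exists_flagOf_eq hK.card_le ⟨hU, hUd⟩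
      have hwv := (erase_subset_flagOf_iff hw.injective hv.injective).1 hsub
      by_cases hwv' : initialSegment w (i + 1) = initialSegment v (i + 1)
      · refine Or.inl (flagOf_congr fun j => ?_)
        by_cases hj : j = i
        · rw [hj, hwv']
        · exact hwv j hj
      · refine Or.inr (flagOf_congr fun j => ?_)
        by_cases hj : j = i
        · rw [hj, hK.initialSegment_eq_of_agreeOff hd hu hv hw huv hwv huv' hwv']
        · rw [hwv j hj, huv j hj]
    · rintro (rfl | rfl)
      · exact ⟨hv.flagOf_mem.1, hv.flagOf_mem.2, Finset.erase_subset _ _⟩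
      · exact ⟨hu.flagOf_mem.1, hu.flagOf_mem.2,
          (erase_subset_flagOf_iff hu.injective hv.injective).2 huv⟩

end IsSingularTriangulation

/-! ### The dual graph is a colored graph -/

/-- Every other label is still carried by a remaining face, so the choice made by
`Classical.epsilon` is forced. -/
theorem dualColor_erase {E : Type*} {v : Fin (d + 1) → E} (hv : v.Injective) (i : Fin (d + 1)) :
    dualColor d simplexDim ((flagOf v).erase (initialSegment v (i + 1))) = i := by
  have hdim : ∀ j : Fin (d + 1), simplexDim (initialSegment v (j + 1)) = j := fun j => by
    rw [simplexDim, card_initialSegment hv (by omega), Nat.add_sub_cancel]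
  have hspec := Classical.epsilon_spec (p := fun c : Fin (d + 1) =>
    ∀ s ∈ (flagOf v).erase (initialSegment v (i + 1)), simplexDim s ≠ (c : ℕ)) ⟨i, by
      intro s hs h
      obtain ⟨hs, hsv⟩ := Finset.mem_erase.1 hs
      obtain ⟨j, rfl⟩ := mem_flagOf.1 hsv
      rw [hdim] at h
      exact hs (by rw [h])⟩
  by_contra hne
  exact hspec _ (Finset.mem_erase.2 ⟨fun h => hne (initialSegment_injective hv h),
    initialSegment_mem_flagOf v _⟩) (hdim _)

theorem IsSingularTriangulation.inc_flagOf_iff (hd : 1 < d) (hK : IsSingularTriangulation d K)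
    {v : Fin (d + 1) → E} (hv : IsOrderedFace K v) {t : Finset (Finset E)} :
    (dualGraph d (barycentricSubdivision K)).Inc t (flagOf v) ↔
      ∃ i : Fin (d + 1), (flagOf v).erase (initialSegment v (i + 1)) = t := by
  constructor
  · rintro ⟨U, -, htd, -, hU⟩
    have htv : t ⊆ flagOf v := (hU.symm.subset (Or.inl rfl)).2.2
    obtain ⟨s, hs, hst⟩ := Finset.exists_eq_insert_iff.2
      ⟨htv, by rw [htd, card_flagOf hv.injective]⟩
    obtain ⟨i, rfl⟩ := mem_flagOf.1 (hst ▸ Finset.mem_insert_self s t)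
    exact ⟨i, by rw [← hst, Finset.erase_insert hs]⟩
  · rintro ⟨i, rfl⟩
    obtain ⟨u, hu, huv, huv'⟩ := hK.exists_agreeOff hd hv i
    exact ⟨_, hK.isLink_flagOf hd hu hv huv huv'⟩

theorem IsSingularTriangulation.isColoredGraph (hd : 1 < d) (hK : IsSingularTriangulation d K) :
    IsColoredGraph d (dualGraph d (barycentricSubdivision K)) (dualColor d simplexDim) where
  finite := by
    refine Set.Finite.subset (Finset.finite_toSet hK.finite.toFinset.powerset) fun A hA => ?_
    simp only [Finset.coe_powerset, Set.mem_preimage, Set.mem_powerset_iff, Set.Finite.coe_toFinset]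
    exact hA.1.2.1
  loopless := ⟨fun t A h => h.2.2.1 rfl⟩
  regular := by
    intro A hA
    obtain ⟨v, hv, rfl⟩ := exists_flagOf_eq hK.card_le hA
    have : {t | (dualGraph d (barycentricSubdivision K)).Inc t (flagOf v)} =
        Set.range fun i : Fin (d + 1) => (flagOf v).erase (initialSegment v (i + 1)) :=
      Set.ext fun t => hK.inc_flagOf_iff hd hv
    rw [this, ← Set.image_univ, Set.ncard_image_of_injective, Set.ncard_univ, Nat.card_fin]
    -- The color of the edge recovers the index of the erased face.
    exact fun i j h => by
      simpa [dualColor_erase hv.injective] using congrArg (dualColor d simplexDim) h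
  color_injective := by
    intro t t' A ht ht' h
    obtain ⟨v, hv, rfl⟩ := exists_flagOf_eq hK.card_le ht.vertex_mem
    obtain ⟨i, rfl⟩ := (hK.inc_flagOf_iff hd hv).1 ht
    obtain ⟨j, rfl⟩ := (hK.inc_flagOf_iff hd hv).1 ht'
    rw [dualColor_erase hv.injective, dualColor_erase hv.injective] at h
    rw [h]

end Flags

section FlagConnectivity

open scoped Classical

/-! ### Connecting flags through adjacent ones -/

variable {E : Type*} {d : ℕ} [AddCommGroup E] [Module ℝ E] {K : SimplicialComplex ℝ E}

/-- Two ordered faces whose flags agree in all dimensions except one outside `I`. -/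
def FlagStep (K : SimplicialComplex ℝ E) (I : Finset (Fin (d + 1))) (u v : Fin (d + 1) → E) :
    Prop :=
  IsOrderedFace K u ∧ IsOrderedFace K v ∧ ∃ i ∉ I, AgreeOff i v u

/-- Bubble sort: a permutation other than the identity has a descent at adjacent positions, and
removing it is a step that changes the flag only in one dimension. Descents never occur at a
dimension in `I`, because there the permutation preserves the set of the first `i + 1` positions. -/
theorem IsOrderedFace.reflTransGen_flagStep_comp {I : Finset (Fin (d + 1))}
    {u : Fin (d + 1) → E} (hu : IsOrderedFace K u) (σ : Equiv.Perm (Fin (d + 1)))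
    (hσ : ∀ i ∈ I, initialSegment (u ∘ σ) (i + 1) = initialSegment u (i + 1)) :
    Relation.ReflTransGen (FlagStep K I) u (u ∘ σ) := by
  by_contra hcon
  -- A lexicographically least counterexample; exchanging a descent makes it smaller.
  obtain ⟨τ, hτ, hmin⟩ := Finset.exists_min_image
    (Finset.univ.filter fun τ : Equiv.Perm (Fin (d + 1)) =>
      (∀ i ∈ I, initialSegment (u ∘ τ) (i + 1) = initialSegment u (i + 1)) ∧
        ¬ Relation.ReflTransGen (FlagStep K I) u (u ∘ τ))
    (fun τ => toLex (τ : Fin (d + 1) → Fin (d + 1))) ⟨σ, by simpa using ⟨hσ, hcon⟩⟩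
  obtain ⟨hτI, hτu⟩ := (Finset.mem_filter.1 hτ).2
  obtain ⟨i, j, hij, hdesc⟩ : ∃ i j : Fin (d + 1), (j : ℕ) = i + 1 ∧ τ j < τ i := by
    by_contra! hasc
    have hmono : Monotone τ := Fin.monotone_iff_le_succ.2 fun i => hasc _ _ (by simp)
    have hid : (τ : Fin (d + 1) → Fin (d + 1)) = id :=
      (hmono.strictMono_of_injective τ.injective).range_inj strictMono_id |>.1
        (by rw [τ.surjective.range_eq, Set.range_id])
    exact hτu (by rw [hid, Function.comp_id])
  have hiI : i ∉ I := by
    intro hi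
    have key : ∀ k, (τ k : ℕ) < i + 1 ↔ (k : ℕ) < i + 1 := fun k => by
      rw [← apply_mem_initialSegment hu.injective, ← hτI i hi,
        ← apply_mem_initialSegment (hu.comp τ).injective, Function.comp]
    have h1 := (key i).2 (by omega)
    have h2 := key j
    rw [Fin.lt_def] at hdesc
    omega
  have hswap : AgreeOff i (u ∘ ⇑(τ * Equiv.swap i j)) (u ∘ τ) := agreeOff_swap (u ∘ τ) hij
  have hlt := Pi.lex_desc (f := (τ : Fin (d + 1) → Fin (d + 1))) (Fin.le_def.2 (by omega)) hdesc
  refine (hmin (τ * Equiv.swap i j) (Finset.mem_filter.2 ⟨Finset.mem_univ _, ?_, ?_⟩)).not_gt hlt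
  · intro k hk
    rw [hswap k (fun h => hiI (h ▸ hk)), hτI k hk]
  · intro h
    exact hτu (h.tail ⟨hu.comp _, hu.comp _, i, hiI, fun k hk => (hswap k hk).symm⟩)

variable [TopologicalSpace E] [IsTopologicalAddGroup E] [ContinuousSMul ℝ E] [T2Space E]

/-- Two ordered faces whose flags agree in the (nonempty) set of dimensions `I` can be connected by
changing the flags in one dimension outside `I` at a time. -/
theorem IsSingularTriangulation.reflTransGen_flagStep (hK : IsSingularTriangulation d K)
    {I : Finset (Fin (d + 1))} (hI : I.Nonempty) {u v : Fin (d + 1) → E} (hu : IsOrderedFace K u)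
    (hv : IsOrderedFace K v)
    (h : ∀ i ∈ I, initialSegment u (i + 1) = initialSegment v (i + 1)) :
    Relation.ReflTransGen (FlagStep K I) u v := by
  -- The face of dimension `m` contains all the other prescribed faces, so any walk of `d`-faces
  -- around it can retain them.
  obtain ⟨m, hmI, hm⟩ := I.exists_maximal hI
  replace hm : ∀ i ∈ I, i ≤ m := fun i hi => (le_total i m).elim id (hm hi)
  have hcard : ∀ {w : Fin (d + 1) → E}, w.Injective → (Finset.univ.image w).card = d + 1 :=
    fun hw => by rw [Finset.card_image_of_injective _ hw]; simp
  have hsub : ∀ w : Fin (d + 1) → E, initialSegment w (m + 1) ⊆ Finset.univ.image w :=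
    fun w => Finset.image_subset_image (Finset.subset_univ _)
  have path := hK.reflTransGen_adjacentAround (hu.initialSegment_mem m.1.succ_pos) hu.mem_faces
    hv.mem_faces (hsub u) (h m hmI ▸ hsub v) (hcard hu.injective) (hcard hv.injective)
  have lift : ∀ T, Relation.ReflTransGen (AdjacentAround d K (initialSegment u (m + 1)))
      (Finset.univ.image u) T → ∃ w : Fin (d + 1) → E, IsOrderedFace K w ∧
        Finset.univ.image w = T ∧
        (∀ i ∈ I, initialSegment w (i + 1) = initialSegment u (i + 1)) ∧
        Relation.ReflTransGen (FlagStep K I) u w := by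
    intro T hT
    induction hT with
    | refl => exact ⟨u, hu, rfl, fun _ _ => rfl, .refl⟩
    | tail _ hadj ih =>
      obtain ⟨w, hw, rfl, hwI, huw⟩ := ih
      obtain ⟨F, a, b, hFd, hmF, haF, hbF, hwF, rfl, -, hbK⟩ := hadj
      obtain ⟨l, -, hl⟩ := Finset.mem_image.1 (hwF.symm.subset (Finset.mem_insert_self a F))
      -- The vertex `a` being dropped lies outside the prescribed faces, so it can be moved to the
      -- last position without disturbing them and then replaced by `b`.
      have hml : m < l := by
        by_contra hml
        refine haF (hmF ?_)
        rw [← hwI m hmI, ← hl, apply_mem_initialSegment hw.injective]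
        have := Fin.le_def.1 (not_lt.1 hml)
        omega
      have hlastI : Fin.last d ∉ I := fun hlast =>
        absurd (hm _ hlast) (not_le.2 (hml.trans_le (Fin.le_last l)))
      let σ := Equiv.swap l (Fin.last d)
      have hσ : ∀ i ∈ I, initialSegment (w ∘ σ) (i + 1) = initialSegment w (i + 1) := by
        intro i hi
        refine initialSegment_comp w σ fun k => ?_
        have h1 := Fin.le_def.1 (hm i hi)
        have h2 := Fin.lt_def.1 hml
        have h3 := Fin.le_def.1 (Fin.le_last l)
        simp only [σ, Equiv.swap_apply_def]
        split_ifs with h4 h5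
        · subst h4; omega
        · subst h5; omega
        · rfl
      have hwσ := hw.comp σ
      have hlast : (w ∘ σ) (Fin.last d) = a := by simp [σ, hl]
      have hseg : initialSegment (w ∘ σ) (Fin.last d) = F := by
        have h1 : insert a F = insert a (initialSegment (w ∘ σ) (Fin.last d)) := by
          rw [← hwF, ← hlast, ← initialSegment_succ, Fin.val_last, initialSegment_eq_image,
            ← Finset.image_image, Finset.image_univ_equiv]
        have h2 : a ∉ initialSegment (w ∘ σ) (Fin.last d) := by
          rw [← hlast, apply_mem_initialSegment hwσ.injective]
          exact lt_irrefl _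
        rw [← Finset.erase_insert h2, ← h1, Finset.erase_insert haF]
      obtain ⟨hz, hzw, hzF⟩ := hwσ.update_last (c := b) (hseg ▸ hbF) (hseg ▸ hbK)
      refine ⟨_, hz, hzF.trans (by rw [hseg]), fun i hi => ?_, ?_⟩
      · rw [hzw i (fun h => hlastI (h ▸ hi)), hσ i hi, hwI i hi]
      · exact (huw.trans (hw.reflTransGen_flagStep_comp σ hσ)).tail
          ⟨hwσ, hz, Fin.last d, hlastI, hzw⟩
  obtain ⟨w, hw, hwv, hwI, huw⟩ := lift _ path
  -- The walk ends at an enumeration of the same `d`-face as `v`; only a permutation remains.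
  have hex : ∀ i, ∃ j, w j = v i := fun i => by
    simpa using hwv.symm.subset (Finset.mem_image_of_mem v (Finset.mem_univ i))
  choose f hf using hex
  have hfi : f.Injective := fun i j hij => hv.injective (by rw [← hf, ← hf, hij])
  have hσ : w ∘ Equiv.ofBijective f (Finite.injective_iff_bijective.1 hfi) = v := funext hf
  have := hw.reflTransGen_flagStep_comp (I := I)
    (Equiv.ofBijective f (Finite.injective_iff_bijective.1 hfi))
    (by rw [hσ]; intro i hi; rw [hwI i hi, h i hi])
  rw [hσ] at this
  exact huw.trans this

end FlagConnectivity

section BarycentricCoordinates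

open scoped Classical

/-! ### Barycentric coordinates on flags -/

variable {E : Type*} {d : ℕ}

/-- The `k`-th vertex weight of the point with barycentric coordinates `x` in the simplex of a flag:
every barycenter of a face of dimension `i ≥ k` contributes `x i / (i + 1)`. -/
noncomputable def tailWeight (x : Fin (d + 1) → ℝ) (k : ℕ) : ℝ :=
  ∑ i ∈ Finset.univ.filter fun i : Fin (d + 1) => k ≤ (i : ℕ), x i / ((i : ℕ) + 1 : ℝ)

theorem tailWeight_succ (x : Fin (d + 1) → ℝ) (i : Fin (d + 1)) :
    tailWeight x i = x i / ((i : ℕ) + 1 : ℝ) + tailWeight x (i + 1) := by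
  have h : (Finset.univ.filter fun j : Fin (d + 1) => (i : ℕ) ≤ j) =
      insert i (Finset.univ.filter fun j : Fin (d + 1) => (i : ℕ) + 1 ≤ j) := by
    ext j
    simp only [Finset.mem_filter, Finset.mem_univ, true_and, Finset.mem_insert, Fin.ext_iff]
    omega
  rw [tailWeight, h, Finset.sum_insert (by simp), tailWeight]

theorem tailWeight_last (x : Fin (d + 1) → ℝ) : tailWeight x (d + 1) = 0 := by
  refine Finset.sum_eq_zero fun i hi => ?_
  have := (Finset.mem_filter.1 hi).2
  omega

/-- Exchange of the order of summation over pairs `j ≤ i`; it converts coordinates at barycenters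
into weights at vertices. -/
theorem sum_tailWeight_smul {M : Type*} [AddCommGroup M] [Module ℝ M] (x : Fin (d + 1) → ℝ)
    (f : Fin (d + 1) → M) :
    ∑ j : Fin (d + 1), tailWeight x j • f j =
      ∑ i : Fin (d + 1), (x i / ((i : ℕ) + 1 : ℝ)) •
        ∑ j ∈ Finset.univ.filter fun j : Fin (d + 1) => (j : ℕ) < i + 1, f j := by
  simp only [tailWeight, Finset.sum_smul, Finset.smul_sum, Finset.sum_filter, Nat.lt_succ_iff]
  rw [Finset.sum_comm]
  simp only [ite_smul, smul_ite, zero_smul, smul_zero]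

theorem sum_tailWeight (x : Fin (d + 1) → ℝ) :
    ∑ j : Fin (d + 1), tailWeight x j = ∑ i, x i := by
  have h := sum_tailWeight_smul x (fun _ => (1 : ℝ))
  simp only [smul_eq_mul, mul_one] at h
  rw [h]
  refine Finset.sum_congr rfl fun i _ => ?_
  have : (Finset.univ.filter fun j : Fin (d + 1) => (j : ℕ) < i + 1).card = i + 1 := by
    rw [Fin.card_filter_val_lt, min_eq_right (by omega)]
  rw [Finset.sum_const, this, nsmul_eq_mul, mul_one]
  push_cast
  rw [div_mul_cancel₀]
  positivity

theorem tailWeight_nonneg {x : Fin (d + 1) → ℝ} (hx : ∀ i, 0 ≤ x i) (k : ℕ) :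
    0 ≤ tailWeight x k :=
  Finset.sum_nonneg fun i _ => div_nonneg (hx i) (by positivity)

theorem tailWeight_antitone {x : Fin (d + 1) → ℝ} (hx : ∀ i, 0 ≤ x i) :
    Antitone (tailWeight x) := fun k l hkl =>
  Finset.sum_le_sum_of_subset_of_nonneg
    (Finset.monotone_filter_right _ fun i _ hi => hkl.trans hi)
    fun i _ _ => div_nonneg (hx i) (by positivity)

/-- Every antitone sequence of weights is the sequence of tail weights of some coordinates. -/
theorem exists_tailWeight_eq (a : Fin (d + 1) → ℝ) (ha : Antitone a) (h0 : ∀ i, 0 ≤ a i) :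
    ∃ x : Fin (d + 1) → ℝ, (∀ i, 0 ≤ x i) ∧ ∀ i : Fin (d + 1), tailWeight x i = a i := by
  let b : ℕ → ℝ := fun k => if h : k < d + 1 then a ⟨k, h⟩ else 0
  have hb : ∀ i : Fin (d + 1), b i = a i := fun i => dif_pos i.2
  have hb' : ∀ i : Fin (d + 1), b (i + 1) ≤ b i := by
    intro i
    rw [hb]
    by_cases h : (i : ℕ) + 1 < d + 1
    · simp only [b, dif_pos h]
      exact ha (Fin.le_def.2 (Nat.le_succ _))
    · simp only [b, dif_neg h]
      exact h0 i
  -- Forced by `tailWeight_succ`; the value 0 of `b` past the end matches `tailWeight_last`.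
  let x : Fin (d + 1) → ℝ := fun i => ((i : ℕ) + 1 : ℝ) * (b i - b (i + 1))
  have hx : ∀ k, k ≤ d + 1 → tailWeight x k = b k := by
    intro k hk
    induction hk using Nat.decreasingInduction with
    | self => rw [tailWeight_last]; simp [b]
    | of_succ k hk ih =>
      have hne : ((k : ℝ) + 1) ≠ 0 := by positivity
      have h1 := tailWeight_succ x ⟨k, hk⟩
      simp only at h1
      rw [h1, ih]
      simp only [x]
      rw [mul_div_cancel_left₀ _ hne]
      ring
  exact ⟨x, fun i => mul_nonneg (by positivity) (sub_nonneg.2 (hb' i)),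
    fun i => by rw [hx i (by omega), hb]⟩

theorem extend_tailWeight_le_iff {v : Fin (d + 1) → E} (hv : v.Injective)
    {x : Fin (d + 1) → ℝ} {t : ℝ} (ht : 0 < t) {e : E} :
    t ≤ Function.extend v (fun j => tailWeight x j) 0 e ↔
      ∃ j : Fin (d + 1), v j = e ∧ t ≤ tailWeight x j := by
  constructor
  · intro h
    by_cases he : ∃ j, v j = e
    · obtain ⟨j, rfl⟩ := he
      rw [hv.extend_apply] at h
      exact ⟨j, rfl, h⟩
    · rw [Function.extend_apply' _ _ _ he] at h
      exact absurd h (not_le.2 ht)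
  · rintro ⟨j, rfl, h⟩
    rwa [hv.extend_apply]

/-- The weights decrease along `v`, so the `i`-th is at least `t` exactly when more than `i`
vertices have weight at least `t`. This count does not refer to the order of the vertices.
Positivity of `t` excludes points off the range of `v`, where the extension is 0. -/
theorem le_tailWeight_iff {v : Fin (d + 1) → E} (hv : v.Injective) {x : Fin (d + 1) → ℝ}
    (hx : ∀ i, 0 ≤ x i) {t : ℝ} (ht : 0 < t) (i : Fin (d + 1)) :
    t ≤ tailWeight x i ↔
      (i : ℕ) < {e | t ≤ Function.extend v (fun j => tailWeight x j) 0 e}.ncard := by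
  have h : {e | t ≤ Function.extend v (fun j => tailWeight x j) 0 e} =
      ((Finset.univ.filter fun j : Fin (d + 1) => t ≤ tailWeight x j).image v : Finset E) := by
    ext e
    rw [Set.mem_ofPred_eq, extend_tailWeight_le_iff hv ht]
    simp [and_comm]
  rw [h, Set.ncard_coe_finset, Finset.card_image_of_injective _ hv]
  constructor
  · intro hi
    have := Finset.card_le_card (s := Finset.Iic i)
      (t := Finset.univ.filter fun j : Fin (d + 1) => t ≤ tailWeight x j) fun j hj => by
        simpa using hi.trans (tailWeight_antitone hx (Fin.le_def.1 (Finset.mem_Iic.1 hj)))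
    rw [Fin.card_Iic] at this
    omega
  · intro hi
    by_contra hcon
    have := Finset.card_le_card (t := Finset.Iio i)
      (s := Finset.univ.filter fun j : Fin (d + 1) => t ≤ tailWeight x j) fun j hj => by
        rw [Finset.mem_Iio]
        by_contra hji
        exact hcon (((Finset.mem_filter.1 hj).2).trans
          (tailWeight_antitone hx (Fin.le_def.1 (not_lt.1 hji))))
    rw [Fin.card_Iio] at this
    omega

/-- The weights of a point determine its coordinates. -/
theorem eq_of_extend_tailWeight_eq {u v : Fin (d + 1) → E} (hu : u.Injective) (hv : v.Injective)
    {x y : Fin (d + 1) → ℝ} (hx : ∀ i, 0 ≤ x i) (hy : ∀ i, 0 ≤ y i)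
    (h : Function.extend u (fun j => tailWeight x j) 0 =
      Function.extend v (fun j => tailWeight y j) 0) : x = y := by
  have hle : ∀ (i : Fin (d + 1)) (t : ℝ), 0 < t → (t ≤ tailWeight x i ↔ t ≤ tailWeight y i) :=
    fun i t ht => by rw [le_tailWeight_iff hu hx ht, le_tailWeight_iff hv hy ht, h]
  have heq : ∀ i : Fin (d + 1), tailWeight x i = tailWeight y i := by
    intro i
    refine le_antisymm ?_ ?_
    · rcases (tailWeight_nonneg hx i).eq_or_lt with h0 | h0
      · rw [← h0]; exact tailWeight_nonneg hy i
      · exact (hle i _ h0).1 le_rfl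
    · rcases (tailWeight_nonneg hy i).eq_or_lt with h0 | h0
      · rw [← h0]; exact tailWeight_nonneg hx i
      · exact (hle i _ h0).2 le_rfl
  funext i
  have hsucc : tailWeight x (i + 1) = tailWeight y (i + 1) := by
    rcases (show (i : ℕ) < d ∨ (i : ℕ) = d by omega) with hi | hi
    · exact heq ⟨i + 1, by omega⟩
    · rw [hi, tailWeight_last, tailWeight_last]
  have h1 := heq i
  rw [tailWeight_succ, tailWeight_succ, hsucc, add_left_inj] at h1
  exact (div_left_inj' (by positivity)).1 h1

/-- The weights of a point determine the faces of the flag with nonzero coordinate. -/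
theorem mem_initialSegment_iff_tailWeight_le {v : Fin (d + 1) → E} (hv : v.Injective)
    {x : Fin (d + 1) → ℝ} (hx : ∀ i, 0 ≤ x i) {i : Fin (d + 1)} (hi : 0 < x i) {e : E} :
    e ∈ initialSegment v (i + 1) ↔
      tailWeight x i ≤ Function.extend v (fun j => tailWeight x j) 0 e := by
  -- A positive coordinate creates a strict drop in weight just after position `i`, so the segment
  -- is a superlevel set.
  have hlt : tailWeight x (i + 1) < tailWeight x i := by
    rw [tailWeight_succ x i]
    have : 0 < x i / ((i : ℕ) + 1 : ℝ) := by positivity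
    linarith
  rw [extend_tailWeight_le_iff hv ((tailWeight_nonneg hx _).trans_lt hlt), mem_initialSegment]
  constructor
  · rintro ⟨j, hj, rfl⟩
    exact ⟨j, rfl, tailWeight_antitone hx (Nat.lt_succ_iff.1 hj)⟩
  · rintro ⟨j, rfl, hj⟩
    refine ⟨j, ?_, rfl⟩
    by_contra hij
    exact absurd hj (not_le.2 ((tailWeight_antitone hx (not_lt.1 hij)).trans_lt hlt))

variable [AddCommGroup E] [Module ℝ E] {K : SimplicialComplex ℝ E}

theorem sum_ite_mem_smul {ι M : Type*} [Fintype ι] [AddCommGroup M] [Module ℝ M] {E : Type*}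
    {w : ι → E} (hw : w.Injective) {T : Finset E} (hT : T ⊆ Finset.univ.image w) (c : E → ℝ)
    (f : E → M) :
    ∑ i, (if w i ∈ T then c (w i) else 0) • f (w i) = ∑ e ∈ T, c e • f e := by
  rw [← Finset.sum_image (s := Finset.univ) (g := w)
    (f := fun e => (if e ∈ T then c e else 0) • f e) hw.injOn, ← Finset.sum_subset hT]
  · exact Finset.sum_congr rfl fun e he => by rw [if_pos he]
  · intro e _ he
    rw [if_neg he, zero_smul]

/-- Barycentric coordinates in a simplicial complex are unique. -/
theorem IsOrderedFace.extend_eq_of_sum_smul_eq {u v : Fin (d + 1) → E} (hu : IsOrderedFace K u)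
    (hv : IsOrderedFace K v) {a b : Fin (d + 1) → ℝ} (ha : ∀ i, 0 ≤ a i) (hb : ∀ i, 0 ≤ b i)
    (ha1 : ∑ i, a i = 1) (hb1 : ∑ i, b i = 1) (h : ∑ i, a i • u i = ∑ i, b i • v i) :
    Function.extend u a 0 = Function.extend v b 0 := by
  have hmem : ∀ {w : Fin (d + 1) → E} {c : Fin (d + 1) → ℝ}, (∀ i, 0 ≤ c i) → ∑ i, c i = 1 →
      ∑ i, c i • w i ∈ convexHull ℝ ((Finset.univ.image w : Finset E) : Set E) := fun hc hc1 =>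
    (convex_convexHull ℝ _).sum_mem (fun i _ => hc i) hc1
      fun i _ => subset_convexHull ℝ _ (by simp)
  -- The point lies in the hull of the common vertices. Its coordinates `c` there, extended by 0,
  -- must equal both given systems by affine independence.
  have hp := K.inter_subset_convexHull hu.mem_faces hv.mem_faces ⟨hmem ha ha1, h ▸ hmem hb hb1⟩
  rw [← Finset.coe_inter, Finset.mem_convexHull'] at hp
  obtain ⟨c, -, hc1, hc⟩ := hp
  have key : ∀ {w : Fin (d + 1) → E} {b : Fin (d + 1) → ℝ}, IsOrderedFace K w →
      Finset.univ.image u ∩ Finset.univ.image v ⊆ Finset.univ.image w → ∑ i, b i = 1 →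
      ∑ i, b i • w i = ∑ i, a i • u i → Function.extend w b 0 =
        fun e => if e ∈ Finset.univ.image u ∩ Finset.univ.image v then c e else 0 := by
    intro w b hw hsub hb1 hbp
    have hind : AffineIndependent ℝ w := by
      have := (K.indep hw.mem_faces).comp_embedding
        (⟨fun i => ⟨w i, by simp⟩, fun i j hij => hw.injective (by simpa using hij)⟩ :
          Fin (d + 1) ↪ (Finset.univ.image w : Finset E))
      exact this
    let c' : E → ℝ := fun e => if e ∈ Finset.univ.image u ∩ Finset.univ.image v then c e else 0
    have h1 := sum_ite_mem_smul hw.injective hsub c fun _ => (1 : ℝ)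
    have h2 := sum_ite_mem_smul hw.injective hsub c fun e => e
    simp only [smul_eq_mul, mul_one] at h1 h2
    have hz := affineIndependent_iff.1 hind Finset.univ (fun i => b i - c' (w i))
      (by rw [Finset.sum_sub_distrib, hb1, h1, hc1, sub_self])
      (by simp only [sub_smul]; rw [Finset.sum_sub_distrib, hbp, h2, hc, sub_self])
    funext e
    by_cases he : ∃ i, w i = e
    · obtain ⟨i, rfl⟩ := he
      rw [hw.injective.extend_apply]
      exact sub_eq_zero.1 (hz i (Finset.mem_univ _))
    · rw [Function.extend_apply' _ _ _ he, if_neg]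
      · rfl
      · exact fun h => he (by simpa using hsub h)
  rw [key hu Finset.inter_subset_left ha1 rfl, key hv Finset.inter_subset_right hb1 h.symm]

/-- The affine map from the standard simplex onto the simplex of the barycentric subdivision
with vertices the barycenters of the faces in `A`. -/
noncomputable def flagMap (d : ℕ) (A : Finset (Finset E)) : (Fin (d + 1) → ℝ) →ₗ[ℝ] E :=
  ∑ s ∈ A, (LinearMap.proj (R := ℝ) (φ := fun _ : Fin (d + 1) => ℝ)
    (Fin.ofNat (d + 1) (simplexDim s))).smulRight ((s.card : ℝ)⁻¹ • ∑ e ∈ s, e)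

theorem flagMap_apply (A : Finset (Finset E)) (x : Fin (d + 1) → ℝ) :
    flagMap d A x =
      ∑ s ∈ A, x (Fin.ofNat (d + 1) (simplexDim s)) • ((s.card : ℝ)⁻¹ • ∑ e ∈ s, e) := by
  simp [flagMap]

theorem ofNat_simplexDim_initialSegment {E : Type*} {v : Fin (d + 1) → E} (hv : v.Injective)
    (i : Fin (d + 1)) : Fin.ofNat (d + 1) (simplexDim (initialSegment v (i + 1))) = i := by
  rw [simplexDim, card_initialSegment hv (by omega), Nat.add_sub_cancel]
  simp

theorem flagMap_flagOf {v : Fin (d + 1) → E} (hv : v.Injective) (x : Fin (d + 1) → ℝ) :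
    flagMap d (flagOf v) x = ∑ j : Fin (d + 1), tailWeight x j • v j := by
  rw [flagMap_apply, flagOf, Finset.sum_image (initialSegment_injective hv).injOn,
    sum_tailWeight_smul]
  refine Finset.sum_congr rfl fun i _ => ?_
  rw [ofNat_simplexDim_initialSegment hv, card_initialSegment hv (by omega), smul_smul,
    initialSegment, Finset.sum_image hv.injOn, div_eq_mul_inv]
  push_cast
  rfl

/-- The erased barycenter has coefficient 0. Hence on a glued facet the map depends only on the
shared `(d-1)`-simplex, so the gluings are respected. -/
theorem flagMap_eq_erase {v : Fin (d + 1) → E} (hv : v.Injective) {x : Fin (d + 1) → ℝ}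
    {i : Fin (d + 1)} (hx : x i = 0) :
    flagMap d (flagOf v) x = flagMap d ((flagOf v).erase (initialSegment v (i + 1))) x := by
  rw [flagMap_apply, flagMap_apply, ← Finset.add_sum_erase _ _ (initialSegment_mem_flagOf v i),
    ofNat_simplexDim_initialSegment hv, hx, zero_smul, zero_add]

theorem IsOrderedFace.flagMap_mem_space {v : Fin (d + 1) → E} (hv : IsOrderedFace K v)
    {x : Fin (d + 1) → ℝ} (hx : x ∈ stdSimplex ℝ (Fin (d + 1))) :
    flagMap d (flagOf v) x ∈ K.space := by
  refine K.convexHull_subset_space hv.mem_faces ?_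
  rw [flagMap_flagOf hv.injective]
  exact (convex_convexHull ℝ _).sum_mem (fun i _ => tailWeight_nonneg hx.1 i)
    ((sum_tailWeight x).trans hx.2) fun i _ => subset_convexHull ℝ _ (by simp)

/-- The simplices of the barycentric subdivision cover each `d`-face. -/
theorem exists_flagMap_eq {S : Finset E} (hS : S ∈ K.faces) (hSd : S.card = d + 1) {p : E}
    (hp : p ∈ convexHull ℝ (S : Set E)) :
    ∃ v : Fin (d + 1) → E, IsOrderedFace K v ∧
      ∃ x ∈ stdSimplex ℝ (Fin (d + 1)), flagMap d (flagOf v) x = p := by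
  obtain ⟨v, hv, rfl⟩ := exists_isOrderedFace hS hSd
  obtain ⟨w, hw0, hw1, hwp⟩ := Finset.mem_convexHull'.1 hp
  rw [Finset.sum_image hv.injective.injOn] at hw1 hwp
  -- Ordering the vertices by decreasing weight selects the flag; antitone weights are tail weights.
  let σ := Tuple.sort fun j => -w (v j)
  have hmono := Tuple.monotone_sort fun j => -w (v j)
  obtain ⟨x, hx0, hx⟩ := exists_tailWeight_eq (fun j => w (v (σ j)))
    (fun i j hij => neg_le_neg_iff.1 (hmono hij)) (fun i => hw0 _ (by simp))
  refine ⟨v ∘ σ, hv.comp σ, x, ⟨hx0, ?_⟩, ?_⟩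
  · rw [← sum_tailWeight, ← hw1, ← Equiv.sum_comp σ fun j => w (v j)]
    exact Finset.sum_congr rfl fun i _ => hx i
  · rw [flagMap_flagOf (hv.comp σ).injective, ← hwp,
      ← Equiv.sum_comp σ fun j => w (v j) • v j]
    exact Finset.sum_congr rfl fun i _ => by rw [hx]; rfl

/-- Two simplices of the barycentric subdivision meet only in common faces, in the same
coordinates. -/
theorem IsOrderedFace.eq_of_flagMap_eq {u v : Fin (d + 1) → E} (hu : IsOrderedFace K u)
    (hv : IsOrderedFace K v) {x y : Fin (d + 1) → ℝ} (hx : x ∈ stdSimplex ℝ (Fin (d + 1)))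
    (hy : y ∈ stdSimplex ℝ (Fin (d + 1))) (h : flagMap d (flagOf u) x = flagMap d (flagOf v) y) :
    x = y ∧ ∀ i, x i ≠ 0 → initialSegment u (i + 1) = initialSegment v (i + 1) := by
  rw [flagMap_flagOf hu.injective, flagMap_flagOf hv.injective] at h
  have hext := hu.extend_eq_of_sum_smul_eq hv (fun i => tailWeight_nonneg hx.1 i)
    (fun i => tailWeight_nonneg hy.1 i) ((sum_tailWeight x).trans hx.2)
    ((sum_tailWeight y).trans hy.2) h
  obtain rfl := eq_of_extend_tailWeight_eq hu.injective hv.injective hx.1 hy.1 hext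
  refine ⟨rfl, fun i hi => ?_⟩
  have hpos := (hx.1 i).lt_of_ne' hi
  ext e
  rw [mem_initialSegment_iff_tailWeight_le hu.injective hx.1 hpos, hext,
    ← mem_initialSegment_iff_tailWeight_le hv.injective hx.1 hpos]

end BarycentricCoordinates

section Representation

open scoped Classical

/-! ### The dual graph represents the polyhedron -/

/-- The restriction of a linear map to the standard simplex is piecewise linear. -/
theorem LinearMap.isPLMap_stdSimplex {ι F : Type*} [Fintype ι] [AddCommGroup F] [Module ℝ F]
    (g : (ι → ℝ) →ₗ[ℝ] F) : IsPLMap (P := stdSimplex ℝ ι) fun x => g x := by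
  let B : Finset (ι → ℝ) := Finset.univ.image fun i => Pi.single i 1
  have hB : (B : Set (ι → ℝ)) = Set.range fun i : ι => (Pi.single i (1 : ℝ) : ι → ℝ) := by
    simp [B]
  have hind : AffineIndependent ℝ ((↑) : B → ι → ℝ) := by
    have h := (Pi.basisFun ℝ ι).linearIndependent.affineIndependent.range
    have h2 : Set.range (Pi.basisFun ℝ ι) = (B : Set (ι → ℝ)) := by
      rw [hB]; congr 1
    rw [h2] at h
    exact h
  -- The simplex with all its faces; `ofErase` removes the empty set.
  let L : SimplicialComplex ℝ (ι → ℝ) := SimplicialComplex.ofErase {s | s ⊆ B}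
    (fun s hs => hind.mono (Finset.coe_subset.2 hs)) (fun s t hts hs => hts.trans hs)
    (fun s hs t ht => by rw [hind.convexHull_inter hs ht])
  refine ⟨L, ?_, ?_, fun s _ => ⟨g.toAffineMap, fun x _ => rfl⟩⟩
  · exact (Set.finite_Iic B).subset fun s hs => hs.1
  · rw [← convexHull_rangle_single_eq_stdSimplex, ← hB]
    refine Set.Subset.antisymm ?_ ?_
    · intro x hx
      obtain ⟨s, hs, hxs⟩ := SimplicialComplex.mem_space_iff.1 hx
      exact convexHull_mono (Finset.coe_subset.2 hs.1) hxs
    · intro x hx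
      refine SimplicialComplex.mem_space_iff.2 ⟨B, ⟨Finset.Subset.refl B, ?_⟩, hx⟩
      rintro (h0 : B = ∅)
      simp [h0] at hx

variable {E : Type*} {d : ℕ} [AddCommGroup E] [Module ℝ E] {K : SimplicialComplex ℝ E}
  [TopologicalSpace E]

theorem IsSingularTriangulation.flagMap_eq_of_inc (hd : 1 < d) (hK : IsSingularTriangulation d K)
    {A t : Finset (Finset E)} (h : (dualGraph d (barycentricSubdivision K)).Inc t A)
    {x : Fin (d + 1) → ℝ} (hx : x (dualColor d simplexDim t) = 0) :
    flagMap d A x = flagMap d t x := by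
  obtain ⟨v, hv, rfl⟩ := exists_flagOf_eq hK.card_le h.vertex_mem
  obtain ⟨i, rfl⟩ := (hK.inc_flagOf_iff hd hv).1 h
  rw [dualColor_erase hv.injective] at hx
  exact flagMap_eq_erase hv.injective hx

/-- The map from the realization of the dual graph to the polyhedron. -/
noncomputable def IsSingularTriangulation.realizationMap (hd : 1 < d)
    (hK : IsSingularTriangulation d K) :
    ColoredRealization (dualGraph d (barycentricSubdivision K)) (dualColor d simplexDim) →
      K.space :=
  Quot.lift (fun p => ⟨flagMap d p.1 p.2, by
    obtain ⟨v, hv, hvp⟩ := exists_flagOf_eq hK.card_le p.1.2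
    exact hvp ▸ hv.flagMap_mem_space p.2.2⟩) (by
    rintro p q ⟨t, ht, hpq, hx⟩
    refine Subtype.ext ?_
    simp only
    rw [hK.flagMap_eq_of_inc hd ⟨_, ht⟩ hx, ← hpq, hK.flagMap_eq_of_inc hd ⟨_, ht.symm⟩ hx])

theorem IsSingularTriangulation.realizationMap_surjective (hd : 1 < d)
    (hK : IsSingularTriangulation d K) : Function.Surjective (hK.realizationMap hd) := by
  rintro ⟨p, hp⟩
  obtain ⟨s, hs, hps⟩ := SimplicialComplex.mem_space_iff.1 hp
  obtain ⟨S, hS, hsS, hSd⟩ := hK.exists_superset hs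
  obtain ⟨v, hv, x, hx, hxp⟩ :=
    exists_flagMap_eq hS hSd (convexHull_mono (Finset.coe_subset.2 hsS) hps)
  exact ⟨Quot.mk _ ⟨⟨flagOf v, hv.flagOf_mem⟩, ⟨x, hx⟩⟩, Subtype.ext hxp⟩

/-- Either the two flags coincide, or they are joined by an edge of color `i` whose gluing applies
to `x`. -/
theorem IsSingularTriangulation.mk_eq_of_flagStep (hd : 1 < d) (hK : IsSingularTriangulation d K)
    {u v : Fin (d + 1) → E} (hu : IsOrderedFace K u) (hv : IsOrderedFace K v)
    {i : Fin (d + 1)} (huv : AgreeOff i v u) (x : stdSimplex ℝ (Fin (d + 1)))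
    (hx : (x : Fin (d + 1) → ℝ) i = 0) :
    Quot.mk (ColoredGluing (dualGraph d (barycentricSubdivision K)) (dualColor d simplexDim))
      ⟨⟨flagOf u, hu.flagOf_mem⟩, x⟩ = Quot.mk _ ⟨⟨flagOf v, hv.flagOf_mem⟩, x⟩ := by
  by_cases h : initialSegment v (i + 1) = initialSegment u (i + 1)
  · have heq : flagOf u = flagOf v := flagOf_congr fun j => by
      by_cases hj : j = i
      · rw [hj, h]
      · exact (huv j hj).symm
    congr 3
  · refine Quot.sound ⟨_, hK.isLink_flagOf hd hv hu huv h, rfl, ?_⟩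
    rwa [dualColor_erase hu.injective]

variable [IsTopologicalAddGroup E] [ContinuousSMul ℝ E]

theorem IsSingularTriangulation.continuous_realizationMap (hd : 1 < d)
    (hK : IsSingularTriangulation d K) : Continuous (hK.realizationMap hd) := by
  refine continuous_quot_lift _ (Continuous.subtype_mk (continuous_sigma fun A => ?_) _)
  exact (flagMap d A.1).continuous_on_pi.comp continuous_subtype_val

/-- Two preimages share the coordinates `x` and the faces in the support `I` of `x`. The chain of
flags from `reflTransGen_flagStep` changes only dimensions where `x` vanishes, so each of its steps
preserves the class of the point. -/
theorem IsSingularTriangulation.realizationMap_injective [T2Space E] (hd : 1 < d)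
    (hK : IsSingularTriangulation d K) : Function.Injective (hK.realizationMap hd) := by
  rintro ⟨⟨A, hA⟩, x⟩ ⟨⟨B, hB⟩, y⟩ h
  obtain ⟨u, hu, rfl⟩ := exists_flagOf_eq hK.card_le hA
  obtain ⟨v, hv, rfl⟩ := exists_flagOf_eq hK.card_le hB
  obtain ⟨hxy, hseg⟩ := hu.eq_of_flagMap_eq hv x.2 y.2 (congrArg Subtype.val h)
  obtain rfl := Subtype.ext hxy
  let I : Finset (Fin (d + 1)) := Finset.univ.filter fun i => (x : Fin (d + 1) → ℝ) i ≠ 0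
  have hI : I.Nonempty := by
    by_contra hI
    rw [Finset.not_nonempty_iff_eq_empty, Finset.filter_eq_empty_iff] at hI
    have h0 : ∑ i, (x : Fin (d + 1) → ℝ) i = 0 :=
      Finset.sum_eq_zero fun i _ => not_not.1 (hI (Finset.mem_univ i))
    exact zero_ne_one (h0.symm.trans x.2.2)
  have path := hK.reflTransGen_flagStep hI hu hv fun i hi => hseg i (Finset.mem_filter.1 hi).2
  clear hseg h
  induction path with
  | refl => rfl
  | tail _ hstep ih =>
    obtain ⟨hw, hv, i, hi, hwv⟩ := hstep
    exact (ih hw hw.flagOf_mem).trans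
      (hK.mk_eq_of_flagStep hd hw hv hwv x (by simpa [I] using hi))

theorem IsSingularTriangulation.represents [T2Space E] (hd : 1 < d)
    (hK : IsSingularTriangulation d K) :
    Represents (dualGraph d (barycentricSubdivision K)) (dualColor d simplexDim) K.space := by
  -- Finitely many simplices make the realization compact, so a continuous bijection onto a
  -- Hausdorff space is a homeomorphism.
  have := (hK.isColoredGraph hd).finite.to_subtype
  let e := Equiv.ofBijective _ ⟨hK.realizationMap_injective hd, hK.realizationMap_surjective hd⟩
  have he : Continuous e := hK.continuous_realizationMap hd
  exact ⟨he.homeoOfEquivCompactToT2, fun A => (flagMap d A.1).isPLMap_stdSimplex⟩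

end Representation

theorem mainTheorem8 (d n : ℕ) (hd : 1 < d) (N : Set (EuclideanSpace ℝ (Fin n)))
    (hN : IsSingularManifold d N) :
    (∃ (V W : Type) (G : Graph V W) (γ : W → Fin (d + 1)),
      IsColoredGraph d G γ ∧ Represents G γ N) ∧
    ∀ K : Geometry.SimplicialComplex ℝ (EuclideanSpace ℝ (Fin n)),
      IsSingularTriangulation d K → K.space = N →
        IsColoredGraph d (dualGraph d (barycentricSubdivision K)) (dualColor d simplexDim) ∧
        Represents (dualGraph d (barycentricSubdivision K)) (dualColor d simplexDim) N := by
  have main : ∀ K : Geometry.SimplicialComplex ℝ (EuclideanSpace ℝ (Fin n)),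
      IsSingularTriangulation d K → K.space = N →
        IsColoredGraph d (dualGraph d (barycentricSubdivision K)) (dualColor d simplexDim) ∧
        Represents (dualGraph d (barycentricSubdivision K)) (dualColor d simplexDim) N := by
    rintro K hK rfl
    exact ⟨hK.isColoredGraph hd, hK.represents hd⟩
  obtain ⟨K, hK, hKN⟩ := hN
  exact ⟨⟨_, _, _, _, main K hK hKN⟩, main⟩
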